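/- Let $p>1$ and let $\mu$ be a Borel probability measure on $\mathbb{R}^2$ with $\int|x|^p\,\mu(\mathrm{d}x)<\infty$, where $|\cdot|$ is the Euclidean norm. Write $X=(X_1,X_2)$ for the identity map of $\mathbb{R}^2$, $\mu_1,\mu_2$ for the marginals of $\mu$, and $\mathbb{E}^\mu_i[u]:=\mathbb{E}^\mu[u(X)\mid X_i]$. Let $\Pi(\mu_1,\mu_2)$ be the set of probability measures on $\mathbb{R}^2$ with marginals $\mu_1,\mu_2$, and for $T:\mathbb{R}^2\to\mathbb{R}^2$ let $\mu^{T}:=\mu\circ(X+T)^{-1}$. Let $\mathbb{W}_p(\nu,\nu'):=\inf_\pi \mathbb{E}^\pi[|X-X'|^p]^{1/p}$, the infimum being over all couplings $\pi$ (laws of pairs $(X,X')$ on $\mathbb{R}^2\times\mathbb{R}^2$) of $\nu$ and $\nu'$. Let $\mathbb{W}_p^{\rm ad}(\nu,\nu')$ be the same infimum over bicausal couplings, i.e. those under which $X$ and $X_1'$ are conditionally independent given $X_1$, and $X'$ and $X_1$ are conditionally independent given $X_1'$. For a set $U$ of probability measures put $\mathbf{d}(\nu,U):=\inf_{\nu'\in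 U}\mathbf{d}(\nu,\nu')$. Consider the following assumptions. - $\mathbf{B}_{\mathbb{W}_p}$: $\mu$ has a density with respect to Lebesgue measure on $\mathbb{R}^2$; for $i=1,2$, $\mu_i(\mathrm{d}x)=q_i(x)\mathbf{1}_{\{x\in I_i\}}\mathrm{d}x$ with $I_i$ an interval and $q_i:I_i\to[0,\infty)$ continuous; and $\mu(\mathrm{d}x)=k(x_1,x_2)\,\mathrm{d}x_2\,\mu_1(\mathrm{d}x_1)$ with $k$ bounded. - $\mathbf{B}_{\mathbb{W}_p^{\rm ad}}$: $\mu(\mathrm{d}x)=\kappa(x_1,x_2)\,\mathrm{d}x_2\,\mu_1(\mathrm{d}x_1)$ with $\kappa$ bounded; and $\mu_2(\mathrm{d}x)=q_2(x)\mathbf{1}_{\{x\in I_2\}}\mathrm{d}x$ with $I_2$ an interval and $q_2:I_2\to[0,\infty)$ continuous. Let $\mathbf{d}\in\{\mathbb{W}_p,\mathbb{W}_p^{\rm ad}\}$ and assume $\mathbf{B}_{\mathbf{d}}$. Then there is a constant $C>0$ such that, for every compactly supported $C^2$ map $\Theta=(\Theta_1,\Theta_2):\mathbb{R}^2\to\mathbb{R}^2$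 satisfying - if $\mathbf{d}=\mathbb{W}_p$: $\operatorname{supp}\Theta\subset M_1\times M_2$ for some $M_1\subsetneq I_1$ and $M_2\subsetneq I_2$; - if $\mathbf{d}=\mathbb{W}_p^{\rm ad}$: $\Theta_1=0$ and $\operatorname{supp}\Theta\subset \mathbb{R}\times M_2$ for some $M_2\subsetneq I_2$, one has $$\limsup_{r\downarrow 0}\frac1r\,\mathbf{d}\big(\mu^{r\Theta},\Pi(\mu_1,\mu_2)\big)\le C\,\Big(\big\|\mathbb{E}^\mu_1[\Theta_1]\big\|_{\mathbb{L}^p(\mu)}+\big\|\mathbb{E}^\mu_2[\Theta_2]\big\|_{\mathbb{L}^p(\mu)}\Big).$$ -/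

import Mathlib

open MeasureTheory Filter Topology
open scoped ENNReal

namespace CouplingProj

/-- The set of probability measures on `α × β` with marginals `μ` and `ν`. -/
def couplings {α β : Type*} [MeasurableSpace α] [MeasurableSpace β]
    (μ : Measure α) (ν : Measure β) : Set (Measure (α × β)) :=
  {π | IsProbabilityMeasure π ∧ π.map Prod.fst = μ ∧ π.map Prod.snd = ν}

/-- The Euclidean distance on the plane (the distance of `ℝ × ℝ` in Mathlib is the sup distance). -/
noncomputable def euclDist (x y : ℝ × ℝ) : ℝ :=
  √((x.1 - y.1) ^ 2 + (x.2 - y.2) ^ 2)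

/-- A law of `(X, X')`, with `X = (X₁, X₂)` and `X' = (X'₁, X'₂)`, is causal if `X` and `X'₁` are
conditionally independent given `X₁`, expressed through bounded Borel functions. -/
def IsCausal (π : Measure ((ℝ × ℝ) × (ℝ × ℝ))) : Prop :=
  ∀ (f : ℝ × ℝ → ℝ) (g : ℝ → ℝ), Measurable f → Measurable g →
    (∃ c, ∀ x, |f x| ≤ c) → (∃ c, ∀ x, |g x| ≤ c) →
    π[fun z => f z.1 * g z.2.1 | MeasurableSpace.comap (fun z => z.1.1) inferInstance]
      =ᵐ[π]
    π[fun z => f z.1 | MeasurableSpace.comap (fun z => z.1.1) inferInstance] *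
      π[fun z => g z.2.1 | MeasurableSpace.comap (fun z => z.1.1) inferInstance]

/-- The couplings that are causal in both directions. -/
def bicausalCouplings (μ ν : Measure (ℝ × ℝ)) : Set (Measure ((ℝ × ℝ) × (ℝ × ℝ))) :=
  {π | π ∈ couplings μ ν ∧ IsCausal π ∧ IsCausal (π.map Prod.swap)}

/-- The `p`-transport cost `E^π[|X - X'|^p]^{1/p}` of a coupling. -/
noncomputable def transportCost (p : ℝ) (π : Measure ((ℝ × ℝ) × (ℝ × ℝ))) : ℝ≥0∞ :=
  (∫⁻ z, ENNReal.ofReal (euclDist z.1 z.2) ^ p ∂π) ^ (1 / p)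

/-- The `p`-Wasserstein distance. -/
noncomputable def wass (p : ℝ) (μ ν : Measure (ℝ × ℝ)) : ℝ≥0∞ :=
  ⨅ π ∈ couplings μ ν, transportCost p π

/-- The adapted `p`-Wasserstein distance. -/
noncomputable def adaptedWass (p : ℝ) (μ ν : Measure (ℝ × ℝ)) : ℝ≥0∞ :=
  ⨅ π ∈ bicausalCouplings μ ν, transportCost p π

/-- The distance from a measure to a set of measures. -/
noncomputable def distToSet (d : Measure (ℝ × ℝ) → Measure (ℝ × ℝ) → ℝ≥0∞)
    (μ : Measure (ℝ × ℝ)) (U : Set (Measure (ℝ × ℝ))) : ℝ≥0∞ :=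
  ⨅ ν ∈ U, d μ ν

/-- The pushforward `μ^T = μ ∘ (X + T)⁻¹`. -/
noncomputable def displace (μ : Measure (ℝ × ℝ)) (T : ℝ × ℝ → ℝ × ℝ) : Measure (ℝ × ℝ) :=
  μ.map (fun x => x + T x)

/-- `μ` has a finite `p`-th moment. -/
def HasFiniteMoment (p : ℝ) (μ : Measure (ℝ × ℝ)) : Prop :=
  ∫⁻ x, ENNReal.ofReal (euclDist x 0) ^ p ∂μ < ∞

/-- `I` is an interval and `ρ(dx) = q(x) 1_{x ∈ I} dx` with `q : I → [0, ∞)` continuous. -/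
def HasContDensityOn (ρ : Measure ℝ) (I : Set ℝ) : Prop :=
  I.OrdConnected ∧ ∃ q : ℝ → ℝ, ContinuousOn q I ∧ (∀ x ∈ I, 0 ≤ q x) ∧
    ρ = volume.withDensity (I.indicator fun x => ENNReal.ofReal (q x))

/-- `μ(dx) = k(x₁, x₂) dx₂ μ₁(dx₁)` with `k` bounded, where `μ₁` is the first marginal of `μ`. -/
def HasBoundedDisintegration (μ : Measure (ℝ × ℝ)) : Prop :=
  ∃ (k : ℝ × ℝ → ℝ) (K : ℝ), Measurable k ∧ (∀ x, 0 ≤ k x ∧ k x ≤ K) ∧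
    μ = ((μ.map Prod.fst).prod volume).withDensity fun x => ENNReal.ofReal (k x)

/-- The assumption on `μ` for the classical Wasserstein distance. -/
structure AssumptionWass (μ : Measure (ℝ × ℝ)) (I₁ I₂ : Set ℝ) : Prop where
  density : ∃ q : ℝ × ℝ → ℝ≥0∞, Measurable q ∧ μ = volume.withDensity q
  marginal₁ : HasContDensityOn (μ.map Prod.fst) I₁
  marginal₂ : HasContDensityOn (μ.map Prod.snd) I₂
  disintegration : HasBoundedDisintegration μ

/-- The assumption on `μ` for the adapted Wasserstein distance; the first marginal is arbitrary. -/
structure AssumptionAdapted (μ : Measure (ℝ × ℝ)) (I₂ : Set ℝ) : Prop where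
  disintegration : HasBoundedDisintegration μ
  marginal₂ : HasContDensityOn (μ.map Prod.snd) I₂

/-- `‖(E₁[Θ₁], E₂[Θ₂])‖ = ‖E^μ[Θ₁(X) | X₁]‖_{L^p} + ‖E^μ[Θ₂(X) | X₂]‖_{L^p}`, with functions of
one coordinate seen as functions on the plane. -/
noncomputable def marginalNorm (p : ℝ) (μ : Measure (ℝ × ℝ)) (Θ : ℝ × ℝ → ℝ × ℝ) : ℝ≥0∞ :=
  eLpNorm (μ[fun x => (Θ x).1 | MeasurableSpace.comap Prod.fst inferInstance])
      (ENNReal.ofReal p) μ +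
    eLpNorm (μ[fun x => (Θ x).2 | MeasurableSpace.comap Prod.snd inferInstance])
      (ENNReal.ofReal p) μ

end CouplingProj

/-!
The distance from `μ^{rΘ}` to the couplings is bounded by transporting its two marginals back to
`μ₁` and `μ₂` separately, by monotone rearrangement on the line, and gluing the two couplings over
`μ^{rΘ}`; by Minkowski's inequality the cost of the glued coupling is at most the sum of the two
one-dimensional costs. When `Θ₁ = 0` the first marginal stays in place, so the glued coupling has
`X'₁ = X₁` and is bicausal.

On the line, let `ρ` be the law of `X`, with density `q`, and `F_r` the distribution function of
`X + r Z`. At `ρ`-almost every `x`, `F_r (x + r c) - F_0 x = r q(x) (c - E[Z | X = x]) + o(r)`: when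
`Z` takes finitely many values this is Lebesgue differentiation of `P(X ≤ t, Z = v)` for each value
`v`, and a bounded `Z` is squeezed between such functions. Hence the rearrangement of `ρ` onto the
law of `X + r Z` moves `x` by `r E[Z | X = x] + o(r)`, and by dominated convergence its `L^p` cost
divided by `r` tends to `‖E[Z | X]‖_{L^p}`.
-/

namespace CouplingProj

open ProbabilityTheory

section AbsolutelyContinuousLaw

variable {ρ : Measure ℝ}

theorem nullSingletonClass_of_absolutelyContinuous (hρ : ρ ≪ volume) : NullSingletonClass ρ :=
  ⟨fun x => hρ (measure_singleton x)⟩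

theorem ae_rnDeriv_toReal_pos [SigmaFinite ρ] (hρ : ρ ≪ volume) :
    ∀ᵐ x ∂ρ, 0 < (ρ.rnDeriv volume x).toReal := by
  filter_upwards [Measure.rnDeriv_pos hρ, hρ (Measure.rnDeriv_lt_top ρ volume)] with x hpos hlt
  exact ENNReal.toReal_pos hpos.ne' hlt.ne

theorem ae_hasDerivAt_setIntegral_Iic {E : Type*} [NormedAddCommGroup E] [NormedSpace ℝ E]
    [CompleteSpace E] [SigmaFinite ρ] (hρ : ρ ≪ volume) {u : ℝ → E} (hu : Integrable u ρ) :
    ∀ᵐ x ∂ρ, HasDerivAt (fun t => ∫ y in Set.Iic t, u y ∂ρ)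
      ((ρ.rnDeriv volume x).toReal • u x) x := by
  have hint : Integrable (fun x => (ρ.rnDeriv volume x).toReal • u x) volume :=
    (integrable_rnDeriv_smul_iff hρ).2 hu
  filter_upwards [hρ (LocallyIntegrable.ae_hasDerivAt_integral hint.locallyIntegrable)] with x hx
  refine ((hx 0).add_const (∫ y in Set.Iic 0, u y ∂ρ)).congr_of_eventuallyEq
    (Eventually.of_forall fun t => ?_)
  simp only [← setIntegral_rnDeriv_smul hρ (f := u) measurableSet_Iic]
  rw [← intervalIntegral.integral_Iic_sub_Iic hint.integrableOn hint.integrableOn, sub_add_cancel]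

theorem ae_hasDerivAt_cdf [IsProbabilityMeasure ρ] (hρ : ρ ≪ volume) :
    ∀ᵐ x ∂ρ, HasDerivAt (cdf ρ) (ρ.rnDeriv volume x).toReal x := by
  have hcdf : ∀ t, ∫ _ in Set.Iic t, (1 : ℝ) ∂ρ = cdf ρ t := fun t => by
    rw [setIntegral_const, smul_eq_mul, mul_one, cdf_eq_real]
  simpa only [hcdf, smul_eq_mul, mul_one] using
    ae_hasDerivAt_setIntegral_Iic hρ (integrable_const (1 : ℝ))

theorem lt_of_monotone_of_hasDerivAt_pos {f : ℝ → ℝ} {f' x y : ℝ} (hf : Monotone f)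
    (hfx : HasDerivAt f f' x) (hf' : 0 < f') (hyx : y < x) : f y < f x := by
  have hslope : Tendsto (slope f x) (𝓝[<] x) (𝓝 f') :=
    hfx.tendsto_slope.mono_left (nhdsWithin_mono x fun _ h => ne_of_lt h)
  obtain ⟨z, hz, hyz, hzx⟩ :=
    ((hslope.eventually (lt_mem_nhds hf')).and (Ioo_mem_nhdsLT hyx)).exists
  rw [slope_comm, slope_pos_iff hzx] at hz
  exact (hf hyz.le).trans_lt hz

theorem ae_cdf_lt_cdf [IsProbabilityMeasure ρ] (hρ : ρ ≪ volume) :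
    ∀ᵐ x ∂ρ, ∀ y < x, cdf ρ y < cdf ρ x := by
  filter_upwards [ae_hasDerivAt_cdf hρ, ae_rnDeriv_toReal_pos hρ] with x hx hpos y hyx
  exact lt_of_monotone_of_hasDerivAt_pos (monotone_cdf ρ) hx hpos hyx

end AbsolutelyContinuousLaw

section ConditionalMean

variable {Ω β : Type*} [MeasurableSpace Ω] [MeasurableSpace β] {μ : Measure Ω} [IsFiniteMeasure μ]
  {X : Ω → β} {Y Z : Ω → ℝ}

/-- The conditional mean `E[Y | X = x]`, as a function of the value `x` of `X`; the regular
conditional distribution fixes a version, canonical up to a null set of the law of `X`. -/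
noncomputable def condMean (μ : Measure Ω) [IsFiniteMeasure μ] (X : Ω → β) (Y : Ω → ℝ)
    (x : β) : ℝ :=
  ∫ y, y ∂condDistrib Y X μ x

theorem stronglyMeasurable_condMean : StronglyMeasurable (condMean μ X Y) :=
  StronglyMeasurable.integral_condDistrib (f := Prod.snd) measurable_snd.stronglyMeasurable

theorem condExp_ae_eq_condMean (hX : Measurable X) (hY : Integrable Y μ) :
    μ[Y | MeasurableSpace.comap X inferInstance] =ᵐ[μ] condMean μ X Y ∘ X :=
  condExp_ae_eq_integral_condDistrib' hX hY

theorem integrable_condMean (hX : Measurable X) (hY : Integrable Y μ) :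
    Integrable (condMean μ X Y) (μ.map X) :=
  (integrable_map_measure stronglyMeasurable_condMean.aestronglyMeasurable hX.aemeasurable).2
    (integrable_condExp.congr (condExp_ae_eq_condMean hX hY))

theorem setIntegral_condMean (hX : Measurable X) (hY : Integrable Y μ) {s : Set β}
    (hs : MeasurableSet s) : ∫ x in s, condMean μ X Y x ∂μ.map X = ∫ ω in X ⁻¹' s, Y ω ∂μ := by
  rw [setIntegral_map hs stronglyMeasurable_condMean.aestronglyMeasurable hX.aemeasurable,
    ← setIntegral_condExp hX.comap_le hY ⟨s, hs, rfl⟩]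
  exact setIntegral_congr_ae (hX hs)
    ((condExp_ae_eq_condMean hX hY).mono fun ω hω _ => hω.symm)

theorem eLpNorm_condMean (hX : Measurable X) (hY : Integrable Y μ) (p : ℝ≥0∞) :
    eLpNorm (condMean μ X Y) p (μ.map X) =
      eLpNorm (μ[Y | MeasurableSpace.comap X inferInstance]) p μ := by
  rw [eLpNorm_map_measure stronglyMeasurable_condMean.aestronglyMeasurable hX.aemeasurable,
    eLpNorm_congr_ae (condExp_ae_eq_condMean hX hY)]

theorem ae_abs_condMean_sub_le (hX : Measurable X) (hY : Integrable Y μ) (hZ : Integrable Z μ)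
    {ε : ℝ} (h : ∀ ω, |Y ω - Z ω| ≤ ε) :
    ∀ᵐ x ∂μ.map X, |condMean μ X Y x - condMean μ X Z x| ≤ ε := by
  have hmeas : Measurable fun x => |condMean μ X Y x - condMean μ X Z x| :=
    (stronglyMeasurable_condMean.sub stronglyMeasurable_condMean).measurable.norm
  rw [ae_map_iff hX.aemeasurable (measurableSet_le hmeas measurable_const)]
  filter_upwards [condExp_ae_eq_condMean hX hY, condExp_ae_eq_condMean hX hZ,
    condExp_sub hY hZ (MeasurableSpace.comap X inferInstance),
    ae_bdd_abs_condExp_of_ae_bdd_abs (m := MeasurableSpace.comap X inferInstance) (f := Y - Z)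
      (Eventually.of_forall h)] with ω hYω hZω hsub hbound
  simpa only [hsub, Pi.sub_apply, hYω, hZω, Function.comp_apply] using hbound

theorem ae_hasDerivAt_setIntegral_preimage_Iic {X : Ω → ℝ} (hX : Measurable X)
    (hY : Integrable Y μ) (hρ : μ.map X ≪ volume) :
    ∀ᵐ x ∂μ.map X, HasDerivAt (fun t => ∫ ω in X ⁻¹' Set.Iic t, Y ω ∂μ)
      (((μ.map X).rnDeriv volume x).toReal * condMean μ X Y x) x := by
  simpa only [setIntegral_condMean hX hY measurableSet_Iic, smul_eq_mul] using
    ae_hasDerivAt_setIntegral_Iic hρ (integrable_condMean hX hY)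

end ConditionalMean

theorem tendsto_of_forall_eventually_mem_Icc {α ι R : Type*} {l : Filter α} {k : Filter ι} [k.NeBot]
    [TopologicalSpace R] [LinearOrder R] [OrderTopology R] {f : α → R} {g h : ι → α → R}
    {a b : ι → R} {L : R} (hf : ∀ i, ∀ᶠ x in l, f x ∈ Set.Icc (g i x) (h i x))
    (hg : ∀ i, Tendsto (g i) l (𝓝 (a i))) (hh : ∀ i, Tendsto (h i) l (𝓝 (b i)))
    (ha : Tendsto a k (𝓝 L)) (hb : Tendsto b k (𝓝 L)) : Tendsto f l (𝓝 L) := by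
  refine tendsto_order.2 ⟨fun c hc => ?_, fun c hc => ?_⟩
  · obtain ⟨i, hci⟩ := (ha.eventually (lt_mem_nhds hc)).exists
    filter_upwards [hf i, (hg i).eventually (lt_mem_nhds hci)] with x hx hcx
    exact hcx.trans_le hx.1
  · obtain ⟨i, hci⟩ := (hb.eventually (gt_mem_nhds hc)).exists
    filter_upwards [hf i, (hh i).eventually (gt_mem_nhds hci)] with x hx hcx
    exact hx.2.trans_lt hcx

section Displacement

variable {Ω : Type*} [MeasurableSpace Ω] {μ : Measure Ω} {X Y Z : Ω → ℝ}

theorem exists_simpleFunc_abs_sub_le (hZ : Measurable Z) {B : ℝ} (hB : ∀ ω, |Z ω| ≤ B) {ε : ℝ}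
    (hε : 0 < ε) : ∃ W : SimpleFunc Ω ℝ, ∀ ω, |W ω - Z ω| ≤ ε := by
  let level : Ω → ℤ := fun ω => ⌊Z ω / ε⌋
  have hlevel : Measurable level := Int.measurable_floor.comp (hZ.div_const ε)
  have hrange : (Set.range level).Finite := by
    refine (Set.finite_Icc ⌊-B / ε⌋ ⌊B / ε⌋).subset ?_
    rintro _ ⟨ω, rfl⟩
    obtain ⟨hlow, hupp⟩ := abs_le.1 (hB ω)
    exact ⟨Int.floor_le_floor (by gcongr), Int.floor_le_floor (by gcongr)⟩
  let W : SimpleFunc Ω ℤ := ⟨level, fun _ => hlevel (measurableSet_singleton _), hrange⟩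
  refine ⟨W.map fun j : ℤ => ε * j, fun ω => ?_⟩
  have hfloor : ε * (Z ω / ε) = Z ω := mul_div_cancel₀ _ hε.ne'
  change |ε * (⌊Z ω / ε⌋ : ℝ) - Z ω| ≤ ε
  rw [abs_sub_comm, ← hfloor, ← mul_sub, hfloor, Int.self_sub_floor, abs_mul, abs_of_pos hε,
    abs_of_nonneg (Int.fract_nonneg _)]
  exact mul_le_of_le_one_right hε.le (Int.fract_lt_one _).le

section SimpleFunc

variable [IsFiniteMeasure μ] (W : SimpleFunc Ω ℝ)

theorem measureReal_eq_sum_inter_fiber (s : Set Ω) :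
    μ.real s = ∑ v ∈ W.range, μ.real (s ∩ W ⁻¹' {v}) := by
  have h := sum_measureReal_preimage_singleton (μ := μ.restrict s) W.range
    fun v _ => W.measurableSet_fiber v
  have hrange : W ⁻¹' (W.range : Set ℝ) = Set.univ := by
    rw [SimpleFunc.coe_range, Set.preimage_range]
  simp only [hrange, measureReal_restrict_apply (W.measurableSet_fiber _),
    measureReal_restrict_apply .univ, Set.univ_inter] at h
  simp only [← h, Set.inter_comm s]

theorem setIntegral_eq_sum_inter_fiber (s : Set Ω) :
    ∫ ω in s, W ω ∂μ = ∑ v ∈ W.range, v * μ.real (s ∩ W ⁻¹' {v}) := by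
  rw [W.integral_eq_sum W.integrable_of_isFiniteMeasure]
  refine Finset.sum_congr rfl fun v _ => ?_
  rw [measureReal_restrict_apply (W.measurableSet_fiber v), smul_eq_mul, mul_comm, Set.inter_comm]

end SimpleFunc

variable [IsProbabilityMeasure μ]

theorem cdf_map (hX : Measurable X) (t : ℝ) : cdf (μ.map X) t = μ.real (X ⁻¹' Set.Iic t) := by
  have := Measure.isProbabilityMeasure_map hX.aemeasurable (μ := μ)
  rw [cdf_eq_real, map_measureReal_apply hX measurableSet_Iic]

theorem cdf_map_le_cdf_map (hX : Measurable X) (hY : Measurable Y) {s t : ℝ}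
    (h : ∀ ω, X ω ≤ s → Y ω ≤ t) : cdf (μ.map X) s ≤ cdf (μ.map Y) t := by
  rw [cdf_map hX, cdf_map hY]
  exact measureReal_mono h

theorem cdf_map_add_smul_eq_sum (hX : Measurable X) (W : SimpleFunc Ω ℝ) (x r c : ℝ) :
    cdf (μ.map (X + r • ⇑W)) (x + r * c) =
      ∑ v ∈ W.range, μ.real (X ⁻¹' Set.Iic (x + r * (c - v)) ∩ W ⁻¹' {v}) := by
  rw [cdf_map (hX.add (W.measurable.const_smul r)), measureReal_eq_sum_inter_fiber W]
  refine Finset.sum_congr rfl fun v _ => congrArg μ.real (Set.ext fun ω => ?_)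
  refine and_congr_left fun (hω : W ω = v) => ?_
  change X ω + r * W ω ≤ x + r * c ↔ X ω ≤ x + r * (c - v)
  rw [hω, mul_sub, ← add_sub_assoc, le_sub_iff_add_le]

theorem ae_hasDerivAt_cdf_map_add_smul_simpleFunc (hX : Measurable X) (hρ : μ.map X ≪ volume)
    (W : SimpleFunc Ω ℝ) :
    ∀ᵐ x ∂μ.map X, ∀ c, HasDerivAt (fun r => cdf (μ.map (X + r • ⇑W)) (x + r * c))
      (((μ.map X).rnDeriv volume x).toReal * (c - condMean μ X W x)) 0 := by
  have := Measure.isProbabilityMeasure_map hX.aemeasurable (μ := μ)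
  let F (v t : ℝ) : ℝ := μ.real (X ⁻¹' Set.Iic t ∩ W ⁻¹' {v})
  have hF_mono (v : ℝ) : Monotone (F v) := fun s t hst =>
    measureReal_mono (Set.inter_subset_inter_left _ (Set.preimage_mono (Set.Iic_subset_Iic.2 hst)))
  have hF_diff : ∀ᵐ x ∂μ.map X, ∀ v ∈ W.range, DifferentiableAt ℝ (F v) x :=
    (ae_ball_iff W.range.countable_toSet).2 fun v _ => hρ (hF_mono v).ae_differentiableAt
  filter_upwards [hF_diff, ae_hasDerivAt_cdf hρ,
    ae_hasDerivAt_setIntegral_preimage_Iic hX W.integrable_of_isFiniteMeasure hρ]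
    with x hdiff hcdf hmean c
  have hF (v) (hv : v ∈ W.range) : HasDerivAt (F v) (deriv (F v) x) x := (hdiff v hv).hasDerivAt
  have hdensity : ((μ.map X).rnDeriv volume x).toReal = ∑ v ∈ W.range, deriv (F v) x := by
    refine hcdf.unique ((HasDerivAt.fun_sum hF).congr_of_eventuallyEq (.of_forall fun t => ?_))
    rw [cdf_map hX, measureReal_eq_sum_inter_fiber W]
  have hmoment : ((μ.map X).rnDeriv volume x).toReal * condMean μ X W x =
      ∑ v ∈ W.range, v * deriv (F v) x :=
    hmean.unique ((HasDerivAt.fun_sum fun v hv => (hF v hv).const_mul v).congr_of_eventuallyEq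
      (.of_forall fun t => setIntegral_eq_sum_inter_fiber W _))
  have hline (v) (hv : v ∈ W.range) :
      HasDerivAt (fun r => F v (x + r * (c - v))) (deriv (F v) x * (c - v)) 0 :=
    (hF v hv).comp_of_eq 0 ((((hasDerivAt_id (0 : ℝ)).mul_const (c - v)).const_add x).congr_deriv
      (one_mul _)) (by simp)
  refine ((HasDerivAt.fun_sum hline).congr_deriv ?_).congr_of_eventuallyEq
    (.of_forall fun r => cdf_map_add_smul_eq_sum hX W x r c)
  rw [mul_sub, hmoment, hdensity, Finset.sum_mul, ← Finset.sum_sub_distrib]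
  exact Finset.sum_congr rfl fun v _ => by ring

theorem cdf_map_add_smul_le_cdf_map_add_smul (hX : Measurable X) (hY : Measurable Y)
    (hZ : Measurable Z) {r c ε : ℝ} (hr : 0 ≤ r) (x : ℝ) (h : ∀ ω, |Y ω - Z ω| ≤ ε) :
    cdf (μ.map (X + r • Y)) (x + r * c) ≤ cdf (μ.map (X + r • Z)) (x + r * (c + ε)) := by
  refine cdf_map_le_cdf_map (hX.add (hY.const_smul r)) (hX.add (hZ.const_smul r)) fun ω hω => ?_
  have hωZ : Z ω ≤ Y ω + ε := by linarith [(abs_le.1 (h ω)).1]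
  calc X ω + r * Z ω ≤ X ω + r * (Y ω + ε) := by gcongr
    _ = X ω + r * Y ω + r * ε := by ring
    _ ≤ x + r * c + r * ε := by gcongr ?_ + _; exact hω
    _ = x + r * (c + ε) := by ring

theorem ae_tendsto_cdf_map_add_smul (hX : Measurable X) (hZ : Measurable Z) {B : ℝ}
    (hB : ∀ ω, |Z ω| ≤ B) (hρ : μ.map X ≪ volume) :
    ∀ᵐ x ∂μ.map X, ∀ c, Tendsto
      (fun r => r⁻¹ * (cdf (μ.map (X + r • Z)) (x + r * c) - cdf (μ.map X) x)) (𝓝[>] 0)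
      (𝓝 (((μ.map X).rnDeriv volume x).toReal * (c - condMean μ X Z x))) := by
  let ε (n : ℕ) : ℝ := 1 / (n + 1)
  have hε : Tendsto ε atTop (𝓝 0) := tendsto_one_div_add_atTop_nhds_zero_nat
  choose W hW using fun n =>
    exists_simpleFunc_abs_sub_le hZ hB (ε := ε n) Nat.one_div_pos_of_nat
  have hZ_int : Integrable Z μ := .of_bound hZ.aestronglyMeasurable B (.of_forall hB)
  filter_upwards [ae_all_iff.2 fun n => ae_hasDerivAt_cdf_map_add_smul_simpleFunc hX hρ (W n),
    ae_all_iff.2 fun n =>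
      ae_abs_condMean_sub_le hX (W n).integrable_of_isFiniteMeasure hZ_int (hW n)]
    with x hderiv hmean c
  have hquot (n : ℕ) (b : ℝ) : Tendsto
      (fun r => r⁻¹ * (cdf (μ.map (X + r • ⇑(W n))) (x + r * b) - cdf (μ.map X) x)) (𝓝[>] 0)
      (𝓝 (((μ.map X).rnDeriv volume x).toReal * (b - condMean μ X (W n) x))) := by
    simpa only [zero_add, zero_smul, add_zero, zero_mul, smul_eq_mul] using
      (hderiv n b).tendsto_slope_zero_right
  have hlim : Tendsto (fun n => condMean μ X (W n) x) atTop (𝓝 (condMean μ X Z x)) :=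
    tendsto_iff_dist_tendsto_zero.2 (squeeze_zero (fun _ => dist_nonneg) hmean hε)
  refine tendsto_of_forall_eventually_mem_Icc (k := atTop) (fun n => ?_)
    (fun n => hquot n (c - ε n)) (fun n => hquot n (c + ε n)) ?_ ?_
  · filter_upwards [self_mem_nhdsWithin] with r (hr : 0 < r)
    have hlow := cdf_map_add_smul_le_cdf_map_add_smul (μ := μ) (c := c - ε n) hX
      (W n).measurable hZ hr.le x (hW n)
    have hupp := cdf_map_add_smul_le_cdf_map_add_smul (μ := μ) (c := c) hX hZ
      (W n).measurable hr.le x fun ω => (abs_sub_comm _ _).trans_le (hW n ω)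
    rw [sub_add_cancel] at hlow
    exact ⟨by gcongr, by gcongr⟩
  · simpa only [sub_zero] using (((tendsto_const_nhds (x := c)).sub hε).sub hlim).const_mul _
  · simpa only [add_zero] using (((tendsto_const_nhds (x := c)).add hε).sub hlim).const_mul _

end Displacement

section Quantile

variable {ν : Measure ℝ}

/-- The quantile function of `ν`, i.e. the left-continuous inverse of its distribution function.
Only its values on `(0, 1)` are meaningful: elsewhere the set may be empty or unbounded below. -/
noncomputable def quantile (ν : Measure ℝ) (t : ℝ) : ℝ :=
  sInf {y | t ≤ cdf ν y}

theorem quantile_le_iff {t : ℝ} (ht : t ∈ Set.Ioo 0 1) {y : ℝ} :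
    quantile ν t ≤ y ↔ t ≤ cdf ν y := by
  have hne : {z | t ≤ cdf ν z}.Nonempty :=
    ((tendsto_cdf_atTop ν).eventually_const_le ht.2).exists
  have hbdd : BddBelow {z | t ≤ cdf ν z} := by
    obtain ⟨z, hz⟩ := ((tendsto_cdf_atBot ν).eventually_lt_const ht.1).exists
    exact ⟨z, fun w hw => ((monotone_cdf ν).reflect_lt (hz.trans_le hw)).le⟩
  refine ⟨fun h => ?_, fun h => csInf_le hbdd h⟩
  have hright : Tendsto (cdf ν) (𝓝[>] y) (𝓝 (cdf ν y)) :=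
    ((cdf ν).right_continuous y).mono_left (nhdsWithin_mono _ Set.Ioi_subset_Ici_self)
  refine ge_of_tendsto hright ?_
  filter_upwards [self_mem_nhdsWithin] with z (hz : y < z)
  obtain ⟨w, hw, hwz⟩ := exists_lt_of_csInf_lt hne (h.trans_lt hz)
  exact le_trans hw (monotone_cdf ν hwz.le)

theorem monotoneOn_quantile : MonotoneOn (quantile ν) (Set.Ioo 0 1) := fun _ hs _ ht hst =>
  (quantile_le_iff hs).2 (hst.trans ((quantile_le_iff ht).1 le_rfl))

theorem aemeasurable_quantile : AEMeasurable (quantile ν) (volume.restrict (Set.Ioo 0 1)) :=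
  aemeasurable_restrict_of_monotoneOn measurableSet_Ioo monotoneOn_quantile

theorem volume_restrict_Ioo_Iic (t : ℝ) :
    volume.restrict (Set.Ioo (0 : ℝ) 1) (Set.Iic t) = ENNReal.ofReal (min t 1) := by
  rw [Measure.restrict_congr_set Ioo_ae_eq_Ioc, Measure.restrict_apply measurableSet_Iic,
    Set.inter_comm, Set.Ioc_inter_Iic, Real.volume_Ioc, sub_zero, min_comm]

theorem map_quantile [IsProbabilityMeasure ν] :
    (volume.restrict (Set.Ioo 0 1)).map (quantile ν) = ν := by
  refine Measure.ext_of_Iic _ _ fun y => ?_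
  rw [Measure.map_apply_of_aemeasurable aemeasurable_quantile measurableSet_Iic, ← ofReal_cdf,
    ← min_eq_left (cdf_le_one ν y), ← volume_restrict_Ioo_Iic]
  refine measure_congr ?_
  filter_upwards [ae_restrict_mem measurableSet_Ioo] with t ht
  exact propext (quantile_le_iff ht)

end Quantile

section MonotoneMap

/-- The monotone rearrangement of `ρ` onto `ν`: the distribution function of `ρ` followed by the
quantile function of `ν`. -/
noncomputable def monotoneMap (ρ ν : Measure ℝ) (x : ℝ) : ℝ :=
  quantile ν (cdf ρ x)

variable {ρ : Measure ℝ} [IsProbabilityMeasure ρ] [NullSingletonClass ρ]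

theorem continuous_cdf : Continuous (cdf ρ) := by
  refine continuous_iff_continuousAt.2 fun x => ?_
  rw [(monotone_cdf ρ).continuousAt_iff_leftLim_eq_rightLim, StieltjesFunction.rightLim_eq]
  have hjump := (cdf ρ).measure_singleton x
  rw [measure_cdf, measure_singleton, eq_comm, ENNReal.ofReal_eq_zero, sub_nonpos] at hjump
  exact le_antisymm ((monotone_cdf ρ).leftLim_le le_rfl) hjump

theorem measure_cdf_le_of_mem_Ioo {t : ℝ} (ht : t ∈ Set.Ioo 0 1) :
    ρ {x | cdf ρ x ≤ t} = ENNReal.ofReal t := by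
  obtain ⟨a, ha⟩ : ∃ a, cdf ρ a = t :=
    mem_range_of_exists_le_of_exists_ge continuous_cdf
      ((tendsto_cdf_atBot ρ).eventually_le_const ht.1).exists
      ((tendsto_cdf_atTop ρ).eventually_const_le ht.2).exists
  have hbdd : BddAbove {x | cdf ρ x ≤ t} := by
    obtain ⟨z, hz⟩ := ((tendsto_cdf_atTop ρ).eventually_const_lt ht.2).exists
    exact ⟨z, fun w hw => ((monotone_cdf ρ).reflect_lt (hw.trans_lt hz)).le⟩
  have hmem : cdf ρ (sSup {x | cdf ρ x ≤ t}) ≤ t :=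
    (isClosed_le continuous_cdf continuous_const).csSup_mem ⟨a, ha.le⟩ hbdd
  have hIic : {x | cdf ρ x ≤ t} = Set.Iic (sSup {x | cdf ρ x ≤ t}) :=
    Set.Subset.antisymm (fun x hx => le_csSup hbdd hx)
      fun x hx => (monotone_cdf ρ hx).trans hmem
  rw [hIic, ← ofReal_cdf, hmem.antisymm (ha.ge.trans (monotone_cdf ρ (le_csSup hbdd ha.le)))]

theorem measure_cdf_le (t : ℝ) : ρ {x | cdf ρ x ≤ t} = ENNReal.ofReal (min t 1) := by
  rcases le_or_gt 1 t with h1 | h1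
  · have huniv : {x | cdf ρ x ≤ t} = Set.univ :=
      Set.eq_univ_of_forall fun x => (cdf_le_one ρ x).trans h1
    rw [huniv, measure_univ, min_eq_right h1, ENNReal.ofReal_one]
  rw [min_eq_left h1.le]
  rcases lt_or_ge 0 t with h0 | h0
  · exact measure_cdf_le_of_mem_Ioo ⟨h0, h1⟩
  rw [ENNReal.ofReal_of_nonpos h0]
  have hlim : Tendsto ENNReal.ofReal (𝓝[>] 0) (𝓝 0) :=
    (ENNReal.continuous_ofReal.tendsto' 0 0 ENNReal.ofReal_zero).mono_left nhdsWithin_le_nhds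
  refine nonpos_iff_eq_zero.1 (ge_of_tendsto hlim ?_)
  filter_upwards [Ioo_mem_nhdsGT one_pos] with s hs
  rw [← measure_cdf_le_of_mem_Ioo (ρ := ρ) hs]
  exact measure_mono fun x hx => hx.trans (h0.trans hs.1.le)

theorem map_cdf : ρ.map (cdf ρ) = volume.restrict (Set.Ioo 0 1) := by
  refine Measure.ext_of_Iic _ _ fun t => ?_
  rw [Measure.map_apply (monotone_cdf ρ).measurable measurableSet_Iic, volume_restrict_Ioo_Iic]
  exact measure_cdf_le t

theorem ae_cdf_mem_Ioo : ∀ᵐ x ∂ρ, cdf ρ x ∈ Set.Ioo 0 1 := by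
  refine ae_of_ae_map (p := (· ∈ Set.Ioo (0 : ℝ) 1)) (monotone_cdf ρ).measurable.aemeasurable ?_
  rw [map_cdf]
  exact ae_restrict_mem measurableSet_Ioo

theorem aemeasurable_quantile_map_cdf {ν : Measure ℝ} :
    AEMeasurable (quantile ν) (ρ.map (cdf ρ)) :=
  map_cdf (ρ := ρ) ▸ aemeasurable_quantile

theorem aemeasurable_monotoneMap {ν : Measure ℝ} : AEMeasurable (monotoneMap ρ ν) ρ :=
  aemeasurable_quantile_map_cdf.comp_measurable (monotone_cdf ρ).measurable

theorem map_monotoneMap (ν : Measure ℝ) [IsProbabilityMeasure ν] :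
    ρ.map (monotoneMap ρ ν) = ν :=
  (AEMeasurable.map_map_of_aemeasurable aemeasurable_quantile_map_cdf
    (monotone_cdf ρ).measurable.aemeasurable).symm.trans (by rw [map_cdf, map_quantile])

end MonotoneMap

theorem tendsto_eLpNorm_of_dominated {α ι E : Type*} [MeasurableSpace α] {μ : Measure α}
    [NormedAddCommGroup E] {l : Filter ι} [l.IsCountablyGenerated] {p : ℝ≥0∞} (hp₀ : p ≠ 0)
    (hp : p ≠ ∞) {F : ι → α → E} {f : α → E} {bound : α → ℝ} (hbound : MemLp bound p μ)
    (hF : ∀ᶠ i in l, AEStronglyMeasurable (F i) μ)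
    (hle : ∀ᶠ i in l, ∀ᵐ x ∂μ, ‖F i x‖ ≤ bound x)
    (hlim : ∀ᵐ x ∂μ, Tendsto (fun i => F i x) l (𝓝 (f x))) :
    Tendsto (fun i => eLpNorm (F i) p μ) l (𝓝 (eLpNorm f p μ)) := by
  simp only [eLpNorm_eq_lintegral_rpow_enorm_toReal hp₀ hp]
  refine (ENNReal.continuous_rpow_const.tendsto _).comp
    (tendsto_lintegral_filter_of_dominated_convergence' (fun x => ‖bound x‖ₑ ^ p.toReal) ?_ ?_
      (lintegral_rpow_enorm_lt_top_of_eLpNorm_lt_top hp₀ hp hbound.eLpNorm_lt_top).ne ?_)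
  · filter_upwards [hF] with i hi
    exact hi.enorm.pow_const _
  · filter_upwards [hle] with i hi
    filter_upwards [hi] with x hx
    gcongr
    exact enorm_le_iff_norm_le.2 (hx.trans (le_abs_self _))
  · filter_upwards [hlim] with x hx
    exact (ENNReal.continuous_rpow_const.tendsto _).comp hx.enorm

section Rate

variable {Ω : Type*} [MeasurableSpace Ω] {μ : Measure Ω} [IsProbabilityMeasure μ]
  {X Z : Ω → ℝ} {B : ℝ}

theorem ae_abs_monotoneMap_sub_le (hX : Measurable X) (hZ : Measurable Z)
    (hB : ∀ ω, |Z ω| ≤ B) (hρ : μ.map X ≪ volume) {r : ℝ} (hr : 0 ≤ r) :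
    ∀ᵐ x ∂μ.map X, |monotoneMap (μ.map X) (μ.map (X + r • Z)) x - x| ≤ r * B := by
  have := Measure.isProbabilityMeasure_map hX.aemeasurable (μ := μ)
  have := nullSingletonClass_of_absolutelyContinuous hρ
  have hdispl (ω : Ω) : |r * Z ω| ≤ r * B := by
    rw [abs_mul, abs_of_nonneg hr]
    exact mul_le_mul_of_nonneg_left (hB ω) hr
  have hXZ : Measurable (X + r • Z) := hX.add (hZ.const_smul r)
  filter_upwards [ae_cdf_lt_cdf hρ, ae_cdf_mem_Ioo (ρ := μ.map X)] with x hx hmem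
  rw [abs_sub_le_iff, sub_le_iff_le_add', sub_le_comm]
  constructor
  · refine (quantile_le_iff hmem).2 (cdf_map_le_cdf_map hX hXZ fun ω hω => ?_)
    exact add_le_add hω (abs_le.1 (hdispl ω)).2
  · refine le_of_forall_lt fun y hy => lt_of_not_ge fun hquantile => ?_
    refine ((quantile_le_iff hmem).1 hquantile).not_gt
      (lt_of_le_of_lt ?_ (hx (y + r * B) (lt_sub_iff_add_lt.1 hy)))
    refine cdf_map_le_cdf_map hXZ hX fun ω (hω : X ω + r * Z ω ≤ y) => ?_
    linarith [(abs_le.1 (hdispl ω)).1]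

theorem ae_tendsto_monotoneMap_sub_div (hX : Measurable X) (hZ : Measurable Z)
    (hB : ∀ ω, |Z ω| ≤ B) (hρ : μ.map X ≪ volume) :
    ∀ᵐ x ∂μ.map X, Tendsto
      (fun r => r⁻¹ * (monotoneMap (μ.map X) (μ.map (X + r • Z)) x - x)) (𝓝[>] 0)
      (𝓝 (condMean μ X Z x)) := by
  have := Measure.isProbabilityMeasure_map hX.aemeasurable (μ := μ)
  have := nullSingletonClass_of_absolutelyContinuous hρ
  filter_upwards [ae_tendsto_cdf_map_add_smul hX hZ hB hρ, ae_rnDeriv_toReal_pos hρ,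
    ae_cdf_mem_Ioo (ρ := μ.map X)] with x hcdf hdensity hmem
  have hle (r c : ℝ) : monotoneMap (μ.map X) (μ.map (X + r • Z)) x ≤ x + r * c ↔
      cdf (μ.map X) x ≤ cdf (μ.map (X + r • Z)) (x + r * c) := quantile_le_iff hmem
  refine tendsto_order.2 ⟨fun c hc => ?_, fun c hc => ?_⟩
  · have hneg : ((μ.map X).rnDeriv volume x).toReal * (c - condMean μ X Z x) < 0 :=
      mul_neg_of_pos_of_neg hdensity (sub_neg.2 hc)
    filter_upwards [(hcdf c).eventually_lt_const hneg, self_mem_nhdsWithin] with r hlt (hr : 0 < r)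
    rw [inv_mul_lt_iff₀ hr, mul_zero, sub_neg, ← not_le, ← hle, not_le] at hlt
    rwa [lt_inv_mul_iff₀ hr, lt_sub_iff_add_lt']
  · obtain ⟨d, hd, hdc⟩ := exists_between hc
    have hpos : 0 < ((μ.map X).rnDeriv volume x).toReal * (d - condMean μ X Z x) :=
      mul_pos hdensity (sub_pos.2 hd)
    filter_upwards [(hcdf d).eventually_const_lt hpos, self_mem_nhdsWithin] with r hlt (hr : 0 < r)
    rw [lt_inv_mul_iff₀ hr, mul_zero, sub_pos] at hlt
    rw [inv_mul_lt_iff₀ hr, sub_lt_iff_lt_add']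
    exact ((hle r d).2 hlt.le).trans_lt (by gcongr)

theorem tendsto_eLpNorm_monotoneMap_sub_id_div {p : ℝ≥0∞} (hp₀ : p ≠ 0) (hp : p ≠ ∞)
    (hX : Measurable X) (hZ : Measurable Z) (hB : ∀ ω, |Z ω| ≤ B) (hρ : μ.map X ≪ volume) :
    Tendsto (fun r => eLpNorm (monotoneMap (μ.map X) (μ.map (X + r • Z)) - id) p (μ.map X) /
        ENNReal.ofReal r) (𝓝[>] 0)
      (𝓝 (eLpNorm (μ[Z | MeasurableSpace.comap X inferInstance]) p μ)) := by
  have := Measure.isProbabilityMeasure_map hX.aemeasurable (μ := μ)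
  have := nullSingletonClass_of_absolutelyContinuous hρ
  have hZ_int : Integrable Z μ := .of_bound hZ.aestronglyMeasurable B (.of_forall hB)
  let T (r : ℝ) : ℝ → ℝ := monotoneMap (μ.map X) (μ.map (X + r • Z))
  let V (r : ℝ) : ℝ → ℝ := r⁻¹ • (T r - id)
  have hV (r : ℝ) : AEStronglyMeasurable (V r) (μ.map X) :=
    ((aemeasurable_monotoneMap.sub aemeasurable_id).const_smul r⁻¹).aestronglyMeasurable
  have hV_le : ∀ᶠ r : ℝ in 𝓝[>] 0, ∀ᵐ x ∂μ.map X, ‖V r x‖ ≤ B := by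
    filter_upwards [self_mem_nhdsWithin] with r (hr : 0 < r)
    filter_upwards [ae_abs_monotoneMap_sub_le hX hZ hB hρ hr.le] with x hx
    change |r⁻¹ * (T r x - x)| ≤ B
    rw [abs_mul, abs_of_pos (inv_pos.2 hr)]
    exact (inv_mul_le_iff₀ hr).2 hx
  rw [← eLpNorm_condMean hX hZ_int]
  refine (tendsto_eLpNorm_of_dominated hp₀ hp (memLp_const B) (.of_forall hV) hV_le
    (ae_tendsto_monotoneMap_sub_div hX hZ hB hρ)).congr' ?_
  filter_upwards [self_mem_nhdsWithin] with r (hr : 0 < r)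
  rw [eLpNorm_const_smul, enorm_inv hr.ne', Real.enorm_of_nonneg hr.le, ENNReal.div_eq_inv_mul]

end Rate

section Glue

variable {α₁ α₂ β₁ β₂ : Type*} [MeasurableSpace α₁] [MeasurableSpace α₂]
  [MeasurableSpace β₁] [StandardBorelSpace β₁] [Nonempty β₁]
  [MeasurableSpace β₂] [StandardBorelSpace β₂] [Nonempty β₂]

/-- The gluing over `ν` of a law `π₁` of `(Y₁, Y'₁)` and a law `π₂` of `(Y₂, Y'₂)`: it is the law of
`((Y₁, Y₂), (Y'₁, Y'₂))` where `(Y₁, Y₂)` has law `ν` and, given `(Y₁, Y₂)`, the coordinates `Y'₁`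
and `Y'₂` are independent and depend on `Y₁` and on `Y₂` only, as under `π₁` and under `π₂`. -/
noncomputable def glue (ν : Measure (α₁ × α₂)) (π₁ : Measure (α₁ × β₁)) [IsFiniteMeasure π₁]
    (π₂ : Measure (α₂ × β₂)) [IsFiniteMeasure π₂] : Measure ((α₁ × α₂) × (β₁ × β₂)) :=
  ν.compProd ((π₁.condKernel.comap Prod.fst measurable_fst).prod
    (π₂.condKernel.comap Prod.snd measurable_snd))

variable {ν : Measure (α₁ × α₂)} {π₁ : Measure (α₁ × β₁)} [IsFiniteMeasure π₁]
  {π₂ : Measure (α₂ × β₂)} [IsFiniteMeasure π₂]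

theorem map_fst_glue [SFinite ν] : (glue ν π₁ π₂).map Prod.fst = ν :=
  Measure.fst_compProd ν _

theorem lintegral_glue [SFinite ν] {f : (α₁ × α₂) × (β₁ × β₂) → ℝ≥0∞} (hf : Measurable f) :
    ∫⁻ z, f z ∂glue ν π₁ π₂ =
      ∫⁻ y, ∫⁻ a, ∫⁻ b, f (y, (a, b)) ∂π₂.condKernel y.2 ∂π₁.condKernel y.1 ∂ν := by
  rw [glue, Measure.lintegral_compProd hf]
  exact lintegral_congr fun y => Kernel.lintegral_prod _ _ y (hf.comp measurable_prodMk_left)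

theorem map_glue_fst_fst [SFinite ν] (h : π₁.map Prod.fst = ν.map Prod.fst) :
    (glue ν π₁ π₂).map (fun z => (z.1.1, z.2.1)) = π₁ := by
  refine Measure.ext_of_lintegral _ fun f hf => ?_
  rw [lintegral_map hf (by fun_prop), lintegral_glue (by fun_prop),
    ← Measure.lintegral_condKernel hf, Measure.fst, h, lintegral_map (by fun_prop) measurable_fst]
  simp only [lintegral_const, measure_univ, mul_one]

theorem map_glue_snd_snd [SFinite ν] (h : π₂.map Prod.fst = ν.map Prod.snd) :
    (glue ν π₁ π₂).map (fun z => (z.1.2, z.2.2)) = π₂ := by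
  refine Measure.ext_of_lintegral _ fun f hf => ?_
  rw [lintegral_map hf (by fun_prop), lintegral_glue (by fun_prop),
    ← Measure.lintegral_condKernel hf, Measure.fst, h, lintegral_map (by fun_prop) measurable_snd]
  simp only [lintegral_const, measure_univ, mul_one]

variable [IsProbabilityMeasure ν]

theorem isProbabilityMeasure_glue : IsProbabilityMeasure (glue ν π₁ π₂) :=
  inferInstanceAs (IsProbabilityMeasure (ν.compProd _))

theorem glue_mem_couplings : glue ν π₁ π₂ ∈ couplings ν ((glue ν π₁ π₂).map Prod.snd) :=
  ⟨isProbabilityMeasure_glue, map_fst_glue, rfl⟩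

theorem map_snd_glue_mem_couplings {μ₁ : Measure β₁} {μ₂ : Measure β₂}
    (h₁ : π₁ ∈ couplings (ν.map Prod.fst) μ₁) (h₂ : π₂ ∈ couplings (ν.map Prod.snd) μ₂) :
    (glue ν π₁ π₂).map Prod.snd ∈ couplings μ₁ μ₂ := by
  have := isProbabilityMeasure_glue (ν := ν) (π₁ := π₁) (π₂ := π₂)
  refine ⟨Measure.isProbabilityMeasure_map measurable_snd.aemeasurable, ?_, ?_⟩
  · calc ((glue ν π₁ π₂).map Prod.snd).map Prod.fst
        = ((glue ν π₁ π₂).map fun z => (z.1.1, z.2.1)).map Prod.snd := by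
          rw [Measure.map_map measurable_fst measurable_snd,
            Measure.map_map measurable_snd (by fun_prop)]
          rfl
      _ = μ₁ := by rw [map_glue_fst_fst h₁.2.1, h₁.2.2]
  · calc ((glue ν π₁ π₂).map Prod.snd).map Prod.snd
        = ((glue ν π₁ π₂).map fun z => (z.1.2, z.2.2)).map Prod.snd := by
          rw [Measure.map_map measurable_snd measurable_snd,
            Measure.map_map measurable_snd (by fun_prop)]
          rfl
      _ = μ₂ := by rw [map_glue_snd_snd h₂.2.1, h₂.2.2]

end Glue

section TransportCost

variable {p : ℝ}

theorem euclDist_le_add_abs (x y : ℝ × ℝ) : euclDist x y ≤ |x.1 - y.1| + |x.2 - y.2| := by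
  refine Real.sqrt_le_iff.2 ⟨by positivity, ?_⟩
  rw [add_sq, sq_abs, sq_abs]
  have : 0 ≤ 2 * |x.1 - y.1| * |x.2 - y.2| := by positivity
  linarith

theorem transportCost_eq_eLpNorm (hp : 0 < p) (π : Measure ((ℝ × ℝ) × (ℝ × ℝ))) :
    transportCost p π = eLpNorm (fun z => euclDist z.1 z.2) (ENNReal.ofReal p) π := by
  rw [eLpNorm_eq_lintegral_rpow_enorm_toReal (ENNReal.ofReal_pos.2 hp).ne' ENNReal.ofReal_ne_top,
    ENNReal.toReal_ofReal hp.le]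
  simp only [Real.enorm_of_nonneg (Real.sqrt_nonneg _), euclDist, transportCost]

theorem transportCost_le_add (hp : 1 ≤ p) (π : Measure ((ℝ × ℝ) × (ℝ × ℝ))) :
    transportCost p π ≤ eLpNorm (fun z => z.1.1 - z.2.1) (ENNReal.ofReal p) π +
      eLpNorm (fun z => z.1.2 - z.2.2) (ENNReal.ofReal p) π := by
  rw [transportCost_eq_eLpNorm (one_pos.trans_le hp),
    ← eLpNorm_norm fun z : (ℝ × ℝ) × (ℝ × ℝ) => z.1.1 - z.2.1,
    ← eLpNorm_norm fun z : (ℝ × ℝ) × (ℝ × ℝ) => z.1.2 - z.2.2]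
  refine (eLpNorm_mono_real fun z => ?_).trans (eLpNorm_add_le
    (Measurable.aestronglyMeasurable (by fun_prop)) (Measurable.aestronglyMeasurable (by fun_prop))
    (ENNReal.one_le_ofReal.2 hp))
  rw [Real.norm_of_nonneg (show 0 ≤ euclDist z.1 z.2 from Real.sqrt_nonneg _)]
  exact euclDist_le_add_abs z.1 z.2

theorem isCausal_of_ae_eq {π : Measure ((ℝ × ℝ) × (ℝ × ℝ))} [IsProbabilityMeasure π]
    (h : ∀ᵐ z ∂π, z.2.1 = z.1.1) : IsCausal π := by
  rintro f g hf hg ⟨c, hc⟩ ⟨d, hd⟩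
  set m := MeasurableSpace.comap (fun z : (ℝ × ℝ) × (ℝ × ℝ) => z.1.1) inferInstance
  have hm : m ≤ Prod.instMeasurableSpace := measurable_fst.fst.comap_le
  have hgm : StronglyMeasurable[m] fun z : (ℝ × ℝ) × (ℝ × ℝ) => g z.1.1 :=
    (hg.comp (comap_measurable _)).stronglyMeasurable
  have hfint : Integrable (fun z : (ℝ × ℝ) × (ℝ × ℝ) => f z.1) π :=
    Integrable.of_bound (hf.comp measurable_fst).aestronglyMeasurable c
      (ae_of_all _ fun z => hc z.1)
  have hgint : Integrable (fun z : (ℝ × ℝ) × (ℝ × ℝ) => g z.1.1) π :=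
    Integrable.of_bound (hgm.mono hm).aestronglyMeasurable d (ae_of_all _ fun z => hd z.1.1)
  have hprod : π[fun z => f z.1 * g z.2.1 | m] =ᵐ[π] π[fun z => g z.1.1 * f z.1 | m] :=
    condExp_congr_ae (h.mono fun z hz => by simp only [hz, mul_comm])
  have hpull : π[fun z => g z.1.1 * f z.1 | m] =ᵐ[π]
      (fun z => g z.1.1) * π[fun z => f z.1 | m] :=
    condExp_stronglyMeasurable_mul_of_bound hm hgm hfint d (ae_of_all _ fun z => hd z.1.1)
  have hself : π[fun z => g z.2.1 | m] =ᵐ[π] fun z => g z.1.1 := by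
    rw [← condExp_of_stronglyMeasurable hm hgm hgint]
    exact condExp_congr_ae (h.mono fun z hz => by simp only [hz])
  filter_upwards [hprod, hpull, hself] with z hz₁ hz₂ hz₃
  rw [hz₁, hz₂, Pi.mul_apply, Pi.mul_apply, hz₃, mul_comm]

variable {ν : Measure (ℝ × ℝ)} [IsProbabilityMeasure ν] {π₁ π₂ : Measure (ℝ × ℝ)}

theorem transportCost_glue_le [IsFiniteMeasure π₁] [IsFiniteMeasure π₂] (hp : 1 ≤ p)
    (h₁ : π₁.map Prod.fst = ν.map Prod.fst) (h₂ : π₂.map Prod.fst = ν.map Prod.snd) :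
    transportCost p (glue ν π₁ π₂) ≤ eLpNorm (fun w => w.1 - w.2) (ENNReal.ofReal p) π₁ +
      eLpNorm (fun w => w.1 - w.2) (ENNReal.ofReal p) π₂ := by
  have hsub (π : Measure (ℝ × ℝ)) : AEStronglyMeasurable (fun w : ℝ × ℝ => w.1 - w.2) π := by
    fun_prop
  have hcost₁ := eLpNorm_map_measure (p := ENNReal.ofReal p) (hsub _)
    (show AEMeasurable (fun z => (z.1.1, z.2.1)) (glue ν π₁ π₂) by fun_prop)
  have hcost₂ := eLpNorm_map_measure (p := ENNReal.ofReal p) (hsub _)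
    (show AEMeasurable (fun z => (z.1.2, z.2.2)) (glue ν π₁ π₂) by fun_prop)
  rw [map_glue_fst_fst h₁] at hcost₁
  rw [map_glue_snd_snd h₂] at hcost₂
  rw [hcost₁, hcost₂]
  exact transportCost_le_add hp _

variable {μ₁ μ₂ : Measure ℝ}

theorem distToSet_wass_le (hp : 1 ≤ p) (h₁ : π₁ ∈ couplings (ν.map Prod.fst) μ₁)
    (h₂ : π₂ ∈ couplings (ν.map Prod.snd) μ₂) :
    distToSet (wass p) ν (couplings μ₁ μ₂) ≤
      eLpNorm (fun w => w.1 - w.2) (ENNReal.ofReal p) π₁ +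
      eLpNorm (fun w => w.1 - w.2) (ENNReal.ofReal p) π₂ := by
  have := h₁.1
  have := h₂.1
  calc distToSet (wass p) ν (couplings μ₁ μ₂)
      ≤ wass p ν ((glue ν π₁ π₂).map Prod.snd) := iInf₂_le _ (map_snd_glue_mem_couplings h₁ h₂)
    _ ≤ transportCost p (glue ν π₁ π₂) := iInf₂_le _ glue_mem_couplings
    _ ≤ _ := transportCost_glue_le hp h₁.2.1 h₂.2.1

theorem map_graph_mem_couplings {ρ : Measure ℝ} [IsProbabilityMeasure ρ] {T : ℝ → ℝ}
    (hT : AEMeasurable T ρ) : ρ.map (fun x => (T x, x)) ∈ couplings (ρ.map T) ρ := by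
  have hgraph : AEMeasurable (fun x => (T x, x)) ρ := hT.prodMk aemeasurable_id
  refine ⟨Measure.isProbabilityMeasure_map hgraph, ?_, ?_⟩
  · exact AEMeasurable.map_map_of_aemeasurable measurable_fst.aemeasurable hgraph
  · exact (AEMeasurable.map_map_of_aemeasurable measurable_snd.aemeasurable hgraph).trans
      Measure.map_id

theorem eLpNorm_sub_map_graph {ρ : Measure ℝ} {T : ℝ → ℝ} (hT : AEMeasurable T ρ) (q : ℝ≥0∞) :
    eLpNorm (fun w => w.1 - w.2) q (ρ.map fun x => (T x, x)) = eLpNorm (T - id) q ρ :=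
  eLpNorm_map_measure (Measurable.aestronglyMeasurable (by fun_prop)) (hT.prodMk aemeasurable_id)

theorem map_monotoneMap_graph_mem_couplings {ρ ρ' : Measure ℝ} [IsProbabilityMeasure ρ]
    [NullSingletonClass ρ] [IsProbabilityMeasure ρ'] :
    ρ.map (fun x => (monotoneMap ρ ρ' x, x)) ∈ couplings ρ' ρ := by
  simpa only [map_monotoneMap] using
    map_graph_mem_couplings (aemeasurable_monotoneMap (ρ := ρ) (ν := ρ'))

theorem glue_mem_bicausalCouplings [IsFiniteMeasure π₁] [IsFiniteMeasure π₂]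
    (h₁ : π₁.map Prod.fst = ν.map Prod.fst) (hdiag : ∀ᵐ w ∂π₁, w.2 = w.1) :
    glue ν π₁ π₂ ∈ bicausalCouplings ν ((glue ν π₁ π₂).map Prod.snd) := by
  have := isProbabilityMeasure_glue (ν := ν) (π₁ := π₁) (π₂ := π₂)
  have := Measure.isProbabilityMeasure_map (μ := glue ν π₁ π₂) measurable_swap.aemeasurable
  have hfst : ∀ᵐ z ∂glue ν π₁ π₂, z.2.1 = z.1.1 := by
    rw [← map_glue_fst_fst (π₂ := π₂) h₁] at hdiag
    exact ae_of_ae_map (by fun_prop) hdiag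
  refine ⟨glue_mem_couplings, isCausal_of_ae_eq hfst, isCausal_of_ae_eq ?_⟩
  rw [ae_map_iff measurable_swap.aemeasurable (measurableSet_eq_fun (by fun_prop) (by fun_prop))]
  exact hfst.mono fun z hz => hz.symm

theorem distToSet_adaptedWass_le (hp : 1 ≤ p) (h₂ : π₂ ∈ couplings (ν.map Prod.snd) μ₂) :
    distToSet (adaptedWass p) ν (couplings (ν.map Prod.fst) μ₂) ≤
      eLpNorm (fun w => w.1 - w.2) (ENNReal.ofReal p) π₂ := by
  have := Measure.isProbabilityMeasure_map (μ := ν) measurable_fst.aemeasurable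
  set π₁ := (ν.map Prod.fst).map fun x => (id x, x) with hπ₁
  have h₁ : π₁ ∈ couplings (ν.map Prod.fst) (ν.map Prod.fst) := by
    simpa only [Measure.map_id] using map_graph_mem_couplings (ρ := ν.map Prod.fst) aemeasurable_id
  have hdiag : ∀ᵐ w ∂π₁, w.2 = w.1 :=
    (ae_map_iff (by fun_prop) (measurableSet_eq_fun (by fun_prop) (by fun_prop))).2
      (ae_of_all _ fun _ => rfl)
  have hcost : eLpNorm (fun w => w.1 - w.2) (ENNReal.ofReal p) π₁ = 0 := by
    rw [hπ₁, eLpNorm_sub_map_graph aemeasurable_id, sub_self, eLpNorm_zero]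
  have := h₂.1
  calc distToSet (adaptedWass p) ν (couplings (ν.map Prod.fst) μ₂)
      ≤ adaptedWass p ν ((glue ν π₁ π₂).map Prod.snd) :=
        iInf₂_le _ (map_snd_glue_mem_couplings h₁ h₂)
    _ ≤ transportCost p (glue ν π₁ π₂) := iInf₂_le _ (glue_mem_bicausalCouplings h₁.2.1 hdiag)
    _ ≤ eLpNorm (fun w => w.1 - w.2) (ENNReal.ofReal p) π₂ := by
      simpa only [hcost, zero_add] using transportCost_glue_le hp h₁.2.1 h₂.2.1

variable [IsProbabilityMeasure μ₂] [NullSingletonClass μ₂]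

theorem distToSet_wass_le_eLpNorm_monotoneMap [IsProbabilityMeasure μ₁] [NullSingletonClass μ₁]
    (hp : 1 ≤ p) :
    distToSet (wass p) ν (couplings μ₁ μ₂) ≤
      eLpNorm (monotoneMap μ₁ (ν.map Prod.fst) - id) (ENNReal.ofReal p) μ₁ +
      eLpNorm (monotoneMap μ₂ (ν.map Prod.snd) - id) (ENNReal.ofReal p) μ₂ := by
  have := Measure.isProbabilityMeasure_map (μ := ν) measurable_fst.aemeasurable
  have := Measure.isProbabilityMeasure_map (μ := ν) measurable_snd.aemeasurable
  rw [← eLpNorm_sub_map_graph aemeasurable_monotoneMap,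
    ← eLpNorm_sub_map_graph aemeasurable_monotoneMap]
  exact distToSet_wass_le hp map_monotoneMap_graph_mem_couplings map_monotoneMap_graph_mem_couplings

theorem distToSet_adaptedWass_le_eLpNorm_monotoneMap (hp : 1 ≤ p) :
    distToSet (adaptedWass p) ν (couplings (ν.map Prod.fst) μ₂) ≤
      eLpNorm (monotoneMap μ₂ (ν.map Prod.snd) - id) (ENNReal.ofReal p) μ₂ := by
  have := Measure.isProbabilityMeasure_map (μ := ν) measurable_snd.aemeasurable
  rw [← eLpNorm_sub_map_graph aemeasurable_monotoneMap]
  exact distToSet_adaptedWass_le hp map_monotoneMap_graph_mem_couplings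

end TransportCost

section Projection

variable {p : ℝ} {μ : Measure (ℝ × ℝ)} {Θ : ℝ × ℝ → ℝ × ℝ}

theorem HasContDensityOn.absolutelyContinuous {ρ : Measure ℝ} {I : Set ℝ}
    (h : HasContDensityOn ρ I) : ρ ≪ volume := by
  obtain ⟨-, q, -, -, rfl⟩ := h
  exact withDensity_absolutelyContinuous _ _

theorem map_fst_displace (hΘ : Measurable Θ) (r : ℝ) :
    (displace μ (r • Θ)).map Prod.fst = μ.map (Prod.fst + r • fun x => (Θ x).1) :=
  Measure.map_map measurable_fst (measurable_id.add (hΘ.const_smul r))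

theorem map_snd_displace (hΘ : Measurable Θ) (r : ℝ) :
    (displace μ (r • Θ)).map Prod.snd = μ.map (Prod.snd + r • fun x => (Θ x).2) :=
  Measure.map_map measurable_snd (measurable_id.add (hΘ.const_smul r))

theorem limsup_div_ofReal_le {f g : ℝ → ℝ≥0∞} {a : ℝ≥0∞} (hfg : f ≤ g)
    (hg : Tendsto (fun r => g r / ENNReal.ofReal r) (𝓝[>] 0) (𝓝 a)) :
    limsup (fun r : ℝ => f r / ENNReal.ofReal r) (𝓝[>] 0) ≤ a := by
  rw [← hg.limsup_eq]
  exact limsup_le_limsup (Eventually.of_forall fun r => ENNReal.div_le_div_right (hfg r) _)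

variable [IsProbabilityMeasure μ]

theorem isProbabilityMeasure_displace {T : ℝ × ℝ → ℝ × ℝ} (hT : Measurable T) :
    IsProbabilityMeasure (displace μ T) :=
  Measure.isProbabilityMeasure_map (measurable_id.add hT).aemeasurable

theorem limsup_distToSet_wass_le (hp : 1 ≤ p) (h₁ : μ.map Prod.fst ≪ volume)
    (h₂ : μ.map Prod.snd ≪ volume) (hΘ : Measurable Θ) (hB : ∃ B, ∀ x, ‖Θ x‖ ≤ B) :
    limsup (fun r : ℝ => distToSet (wass p) (displace μ (r • Θ))
      (couplings (μ.map Prod.fst) (μ.map Prod.snd)) / ENNReal.ofReal r) (𝓝[>] 0) ≤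
      marginalNorm p μ Θ := by
  obtain ⟨B, hB⟩ := hB
  have hq : ENNReal.ofReal p ≠ 0 := (ENNReal.ofReal_pos.2 (one_pos.trans_le hp)).ne'
  have hlim := (tendsto_eLpNorm_monotoneMap_sub_id_div hq ENNReal.ofReal_ne_top measurable_fst
    hΘ.fst (fun x => (norm_fst_le (Θ x)).trans (hB x)) h₁).add
    (tendsto_eLpNorm_monotoneMap_sub_id_div hq ENNReal.ofReal_ne_top measurable_snd
    hΘ.snd (fun x => (norm_snd_le (Θ x)).trans (hB x)) h₂)
  simp only [← ENNReal.add_div] at hlim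
  refine limsup_div_ofReal_le (fun r => ?_) hlim
  have := isProbabilityMeasure_displace (μ := μ) (hΘ.const_smul r)
  rw [← map_fst_displace hΘ, ← map_snd_displace hΘ]
  have := nullSingletonClass_of_absolutelyContinuous h₁
  have := nullSingletonClass_of_absolutelyContinuous h₂
  have := Measure.isProbabilityMeasure_map (μ := μ) measurable_fst.aemeasurable
  have := Measure.isProbabilityMeasure_map (μ := μ) measurable_snd.aemeasurable
  exact distToSet_wass_le_eLpNorm_monotoneMap hp

theorem limsup_distToSet_adaptedWass_le (hp : 1 ≤ p) (h₂ : μ.map Prod.snd ≪ volume)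
    (hΘ : Measurable Θ) (hB : ∃ B, ∀ x, ‖Θ x‖ ≤ B) (hΘ₁ : ∀ x, (Θ x).1 = 0) :
    limsup (fun r : ℝ => distToSet (adaptedWass p) (displace μ (r • Θ))
      (couplings (μ.map Prod.fst) (μ.map Prod.snd)) / ENNReal.ofReal r) (𝓝[>] 0) ≤
      marginalNorm p μ Θ := by
  obtain ⟨B, hB⟩ := hB
  have hlim := tendsto_eLpNorm_monotoneMap_sub_id_div
    (ENNReal.ofReal_pos.2 (one_pos.trans_le hp)).ne' ENNReal.ofReal_ne_top measurable_snd
    hΘ.snd (fun x => (norm_snd_le (Θ x)).trans (hB x)) h₂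
  refine (limsup_div_ofReal_le (fun r => ?_) hlim).trans le_add_self
  have := isProbabilityMeasure_displace (μ := μ) (hΘ.const_smul r)
  have hfst : μ.map Prod.fst = (displace μ (r • Θ)).map Prod.fst := by
    simp only [map_fst_displace hΘ, hΘ₁, ← Pi.zero_def, smul_zero, add_zero]
  rw [hfst, ← map_snd_displace hΘ]
  have := nullSingletonClass_of_absolutelyContinuous h₂
  have := Measure.isProbabilityMeasure_map (μ := μ) measurable_snd.aemeasurable
  exact distToSet_adaptedWass_le_eLpNorm_monotoneMap hp

end Projection

end CouplingProj

theorem mainTheorem6_general {p : ℝ} (hp : 1 ≤ p) {μ : Measure (ℝ × ℝ)} [IsProbabilityMeasure μ]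
    (h₂ : μ.map Prod.snd ≪ volume) {Θ : ℝ × ℝ → ℝ × ℝ} (hΘ : Measurable Θ)
    (hB : ∃ B, ∀ x, ‖Θ x‖ ≤ B) :
    (μ.map Prod.fst ≪ volume →
      limsup (fun r : ℝ =>
          CouplingProj.distToSet (CouplingProj.wass p) (CouplingProj.displace μ (r • Θ))
            (CouplingProj.couplings (μ.map Prod.fst) (μ.map Prod.snd)) / ENNReal.ofReal r)
        (𝓝[>] 0) ≤ CouplingProj.marginalNorm p μ Θ) ∧
    ((∀ x, (Θ x).1 = 0) →
      limsup (fun r : ℝ =>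
          CouplingProj.distToSet (CouplingProj.adaptedWass p) (CouplingProj.displace μ (r • Θ))
            (CouplingProj.couplings (μ.map Prod.fst) (μ.map Prod.snd)) / ENNReal.ofReal r)
        (𝓝[>] 0) ≤ CouplingProj.marginalNorm p μ Θ) :=
  ⟨fun h₁ => CouplingProj.limsup_distToSet_wass_le hp h₁ h₂ hΘ hB,
    CouplingProj.limsup_distToSet_adaptedWass_le hp h₂ hΘ hB⟩

theorem mainTheorem6 (p : ℝ) (hp : 1 < p) (μ : Measure (ℝ × ℝ)) [IsProbabilityMeasure μ]
    (hμ : CouplingProj.HasFiniteMoment p μ) (I₁ I₂ : Set ℝ) :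
    (CouplingProj.AssumptionWass μ I₁ I₂ →
      ∃ C : ℝ, 0 < C ∧ ∀ Θ : ℝ × ℝ → ℝ × ℝ, ContDiff ℝ 2 Θ → HasCompactSupport Θ →
        (∃ M₁ M₂ : Set ℝ, M₁ ⊂ I₁ ∧ M₂ ⊂ I₂ ∧ tsupport Θ ⊆ M₁ ×ˢ M₂) →
        limsup (fun r : ℝ =>
            CouplingProj.distToSet (CouplingProj.wass p) (CouplingProj.displace μ (r • Θ))
              (CouplingProj.couplings (μ.map Prod.fst) (μ.map Prod.snd)) / ENNReal.ofReal r)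
          (𝓝[>] 0) ≤ ENNReal.ofReal C * CouplingProj.marginalNorm p μ Θ) ∧
    (CouplingProj.AssumptionAdapted μ I₂ →
      ∃ C : ℝ, 0 < C ∧ ∀ Θ : ℝ × ℝ → ℝ × ℝ, ContDiff ℝ 2 Θ → HasCompactSupport Θ →
        (∀ x, (Θ x).1 = 0) →
        (∃ M₂ : Set ℝ, M₂ ⊂ I₂ ∧ tsupport Θ ⊆ Set.univ ×ˢ M₂) →
        limsup (fun r : ℝ =>
            CouplingProj.distToSet (CouplingProj.adaptedWass p) (CouplingProj.displace μ (r • Θ))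
              (CouplingProj.couplings (μ.map Prod.fst) (μ.map Prod.snd)) / ENNReal.ofReal r)
          (𝓝[>] 0) ≤ ENNReal.ofReal C * CouplingProj.marginalNorm p μ Θ) := by
  refine ⟨fun h => ⟨1, one_pos, fun Θ hΘ hsupp _ => ?_⟩,
    fun h => ⟨1, one_pos, fun Θ hΘ hsupp hΘ₁ _ => ?_⟩⟩ <;>
  rw [ENNReal.ofReal_one, one_mul]
  · exact (mainTheorem6_general hp.le h.marginal₂.absolutelyContinuous hΘ.continuous.measurable
      (hsupp.exists_bound_of_continuous hΘ.continuous)).1 h.marginal₁.absolutelyContinuous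
  · exact (mainTheorem6_general hp.le h.marginal₂.absolutelyContinuous hΘ.continuous.measurable
      (hsupp.exists_bound_of_continuous hΘ.continuous)).2 hΘ₁
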